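/- Let $\mathcal G=(\mathcal F,\mathcal B,\mathcal E)$ be a finite bipartite graph of frontends $\mathcal F$ and backends $\mathcal B$ without isolated vertices. Write $\mathcal B(f)$ and $\mathcal F(b)$ for the sets of neighbours of $f\in\mathcal F$ and $b\in\mathcal B$. Let $\lambda_f\ge 0$ $(f\in\mathcal F)$ be arrival rates, and for $b\in\mathcal B$ let $\mu_b:[0,\infty)\to\mathbb R$ be strictly increasing, strictly concave, bounded and twice continuously differentiable with $\mu_b(0)=0$; put $\mu_b(\infty)=\lim_{n\to\infty}\mu_b(n)$. (The system may be overloaded.) *Fluid solutions under the Greatest Marginal Service Rate policy (GMSR).* For $N\in[0,\infty)^{\mathcal B}$ let $X_f(N)$ be the set of maximizers of $\sum_{b\in\mathcal B(f)}x_{f,b}\,\mu_b'(N_b)$ over all $(x_{f,b})_{b\in\mathcal B}$ with $\sum_{b}x_{f,b}=1$, $x_{f,b}\ge 0$ for $(f,b)\in\mathcal E$ and $x_{f,b}=0$ for $(f,b)\notin\mathcal E$. Let $H(N)$ be the set of all $v\in\mathbb R^{\mathcal B}$ for which there are $x_f\in X_f(N)$, $f\in\mathcal F$, such that $v_b=\sum_{f}\lambda_f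 x_{f,b}-\mu_b(N_b)$ for all $b\in\mathcal B$. A fluid solution is a locally absolutely continuous $N:[0,\infty)\to[0,\infty)^{\mathcal B}$, with any initial state, such that $\dot N(t)\in H(N(t))$ for almost every $t$. *Stability decomposition.* This is a pair $\tilde{\mathcal F}\subseteq\mathcal F$, $\tilde{\mathcal B}\subseteq\mathcal B$ such that 1. $\tilde{\mathcal F}=\bigcup_{b\in\tilde{\mathcal B}}\mathcal F(b)$; 2. $\sum_{f\in P}\lambda_f<\sum_{b\in\tilde{\mathcal B}\cap\bigcup_{f\in P}\mathcal B(f)}\mu_b(\infty)$ for every nonempty $P\subseteq\tilde{\mathcal F}$; 3. $\sum_{f\in(\bigcup_{b\in Q}\mathcal F(b))\setminus\tilde{\mathcal F}}\lambda_f\ge\sum_{b\in Q}\mu_b(\infty)$ for every $Q\subseteq\mathcal B\setminus\tilde{\mathcal B}$. **Theorem.** There is exactly one stability decomposition $(\tilde{\mathcal F},\tilde{\mathcal B})$. With $\tilde{\mathcal E}=\{(f,b)\in\mathcal E: f\in\tilde{\mathcal F},\,b\in\tilde{\mathcal B}\}$, the optimization problem $$\min\ \sum_{b\in\tilde{\mathcal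 B}}N_b\quad\text{s.t.}\quad \sum_{f\in\tilde{\mathcal F}}\lambda_f x_{f,b}=\mu_b(N_b)\ (b\in\tilde{\mathcal B}),\quad \sum_{b\in\tilde{\mathcal B}}x_{f,b}=1\ (f\in\tilde{\mathcal F}),\quad x_{f,b}\ge0\ ((f,b)\in\tilde{\mathcal E}),\quad x_{f,b}=0\ ((f,b)\notin\tilde{\mathcal E})$$ over $N\in[0,\infty)^{\tilde{\mathcal B}}$ and $x\in\mathbb R^{\tilde{\mathcal F}\times\tilde{\mathcal B}}$ has an optimal solution, and its workload part $\tilde N^*$ is unique. Every fluid solution $N(\cdot)$ satisfies $$\lim_{t\to\infty}\mu_b(N_b(t))=\mu_b(\tilde N^*_b)\ \text{ for all } b\in\tilde{\mathcal B},\qquad \lim_{t\to\infty}\mu_b(N_b(t))=\mu_b(\infty)\ \text{ for all } b\in\mathcal B\setminus\tilde{\mathcal B}.$$ -/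

import Mathlib

open Set Filter Topology MeasureTheory

/-- The data of a bipartite load balancing system: the compatibility relation between frontends
`F` and backends `B`, the arrival rates of the frontends, and the service rate functions of the
backends. Only the values of `mu b` on `[0, ∞)` are meaningful. -/
structure Network (F B : Type*) where
  /-- `adj f b` means that frontend `f` can route jobs to backend `b`. -/
  adj : F → B → Prop
  /-- The arrival rates. -/
  lam : F → ℝ
  /-- The service rate at each backend as a function of its workload. -/
  mu : B → ℝ → ℝ

namespace Network

variable {F B : Type*}

/-- The standing assumptions on the data. Feasibility of the fluid problem is not among them:
the system may be overloaded. -/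
structure Admissible (S : Network F B) : Prop where
  frontend_not_isolated : ∀ f, ∃ b, S.adj f b
  backend_not_isolated : ∀ b, ∃ f, S.adj f b
  lam_nonneg : ∀ f, 0 ≤ S.lam f
  mu_zero : ∀ b, S.mu b 0 = 0
  mu_strictMono : ∀ b, StrictMonoOn (S.mu b) (Ici 0)
  mu_strictConcave : ∀ b, StrictConcaveOn ℝ (Ici 0) (S.mu b)
  mu_bounded : ∀ b, ∃ C, ∀ n, 0 ≤ n → |S.mu b n| ≤ C
  mu_contDiff : ∀ b, ContDiffOn ℝ 2 (S.mu b) (Ici 0)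

/-- The capacity `μ_b(∞)`, the limit of `μ_b` at infinity. -/
noncomputable def capacity (S : Network F B) (b : B) : ℝ := limUnder atTop (S.mu b)

/-- Under the standing assumptions the limit that defines the capacity exists. -/
theorem Admissible.tendsto_capacity {S : Network F B} (hS : S.Admissible) (b : B) :
    Tendsto (S.mu b) atTop (𝓝 (S.capacity b)) := by
  obtain ⟨C, hC⟩ := hS.mu_bounded b
  have hmono : Monotone fun n : ℝ => S.mu b (max n 0) := fun m n hmn =>
    (hS.mu_strictMono b).monotoneOn (mem_Ici.2 (le_max_right _ _)) (mem_Ici.2 (le_max_right _ _))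
      (max_le_max_right 0 hmn)
  have hbdd : BddAbove (range fun n : ℝ => S.mu b (max n 0)) := by
    refine ⟨C, ?_⟩
    rintro _ ⟨n, rfl⟩
    exact (le_abs_self _).trans (hC _ (le_max_right _ _))
  refine tendsto_nhds_limUnder ⟨_, (tendsto_atTop_ciSup hmono hbdd).congr' ?_⟩
  filter_upwards [eventually_ge_atTop (0 : ℝ)] with n hn
  rw [max_eq_left hn]

/-- The marginal service rate `μ_b'(n)` at workload `n ≥ 0` (one-sided at `n = 0`). -/
noncomputable def marginalRate (S : Network F B) (b : B) (n : ℝ) : ℝ :=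
  derivWithin (S.mu b) (Ici 0) n

section Dynamics

variable [Fintype F] [Fintype B]

/-- The possible routing proportions of frontend `f`: probability vectors on the backends that
are supported on the neighbours of `f`. -/
def routing (S : Network F B) (f : F) : Set (B → ℝ) :=
  {y | ∑ b, y b = 1 ∧ (∀ b, S.adj f b → 0 ≤ y b) ∧ ∀ b, ¬ S.adj f b → y b = 0}

open Classical in
/-- The set `X_f(N)` of routing proportions that the Greatest Marginal Service Rate policy allows
frontend `f` to use at workloads `N`. -/
def gmsr (S : Network F B) (f : F) (N : B → ℝ) : Set (B → ℝ) :=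
  {y | y ∈ S.routing f ∧
    IsMaxOn (fun z : B → ℝ => ∑ b with S.adj f b, z b * S.marginalRate b (N b)) (S.routing f) y}

/-- The set `H(N)` of velocities that are possible at workloads `N`. -/
def velocities (S : Network F B) (N : B → ℝ) : Set (B → ℝ) :=
  {v | ∃ x : F → B → ℝ, (∀ f, x f ∈ S.gmsr f N) ∧
    ∀ b, v b = ∑ f, S.lam f * x f b - S.mu b (N b)}

/-- `N` is a fluid solution on `[0, ∞)`: a (locally) absolutely continuous curve of nonnegative
workload vectors which satisfies `N'(t) ∈ H(N(t))` for almost every `t`. -/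
structure IsFluidSolution (S : Network F B) (N : ℝ → B → ℝ) : Prop where
  nonneg : ∀ t, 0 ≤ t → ∀ b, 0 ≤ N t b
  absolutelyContinuous : ∀ T, 0 ≤ T → AbsolutelyContinuousOnInterval N 0 T
  inclusion : ∀ᵐ t ∂(volume : Measure ℝ), 0 < t → ∃ v ∈ S.velocities (N t), HasDerivAt N v t

/-- Feasibility of `(N, x)` for the fluid optimization problem. -/
structure FluidFeasible (S : Network F B) (N : B → ℝ) (x : F → B → ℝ) : Prop where
  workload_nonneg : ∀ b, 0 ≤ N b
  balance : ∀ b, ∑ f, S.lam f * x f b = S.mu b (N b)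
  sum_eq_one : ∀ f, ∑ b, x f b = 1
  nonneg : ∀ f b, S.adj f b → 0 ≤ x f b
  support : ∀ f b, ¬ S.adj f b → x f b = 0

/-- `(N, x)` is an optimal solution of the fluid optimization problem: minimize `∑ b, N b` over
all feasible pairs. -/
def FluidOptimal (S : Network F B) (N : B → ℝ) (x : F → B → ℝ) : Prop :=
  S.FluidFeasible N x ∧ ∀ N' x', S.FluidFeasible N' x' → ∑ b, N b ≤ ∑ b, N' b

end Dynamics

/-- The subsystem that consists of the frontends in `Ft`, the backends in `Bt` and the edges
between them. -/
def restrict (S : Network F B) (Ft : Finset F) (Bt : Finset B) :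
    Network {f // f ∈ Ft} {b // b ∈ Bt} where
  adj f b := S.adj f b
  lam f := S.lam f
  mu b := S.mu b

open Classical in
/-- `(Ft, Bt)` is a stability decomposition of the system. -/
structure IsStabilityDecomposition [Fintype F] [Fintype B] (S : Network F B)
    (Ft : Finset F) (Bt : Finset B) : Prop where
  /-- `Ft` is the set of all frontends connected to a backend in `Bt`. -/
  frontends : ∀ f, f ∈ Ft ↔ ∃ b ∈ Bt, S.adj f b
  /-- Every nonempty set of frontends in `Ft` has less arrivals than the capacity of the backends
  in `Bt` connected to it. -/
  stable : ∀ P ⊆ Ft, P.Nonempty →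
    ∑ f ∈ P, S.lam f < ∑ b ∈ Bt with ∃ f ∈ P, S.adj f b, S.capacity b
  /-- The capacity of every set of backends outside `Bt` is at most the arrivals at the frontends
  outside `Ft` connected to it. -/
  overloaded : ∀ Q : Finset B, Disjoint Q Bt →
    ∑ b ∈ Q, S.capacity b ≤ ∑ f with (∃ b ∈ Q, S.adj f b) ∧ f ∉ Ft, S.lam f

end Network

/-! Greedy routing is monotone. If the rates of the backends in `P` strictly increase and no other
rate increases, each frontend that used `P` before sends everything to `P` afterwards. Marginal
rates decrease in the workload. So if two greedily routed states are compared, the backends where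
the first has the larger workload receive in total no more in the first than in the second, yet they
serve more. Hence the sum of the positive parts `(N b - M b)⁺` is drained (`sum_inflow_le`,
`tendsto_posPart_zero`): equilibria attract fluid solutions from above, and states whose arrivals
are at least their service rates attract them from below.

An overloaded system has no equilibrium, so departures at rate `ε n` are added. A routing of least
total workload then is an equilibrium, by an exchange argument. As `ε → 0`, the workloads converge
in `[0, ∞]` along a subsequence. The set `W` of backends with finite limit is the stable set; the
others have limiting rate 0 and are used only by frontends without a neighbour in `W`. The limit is
the upper barrier on `W`. The perturbed equilibria are lower barriers, which converge to it on `W`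
and to infinity elsewhere.

Flow balance in the limit gives the stability decomposition. It is unique because the complement of
the stable backends is the largest maximizer of confined arrivals minus capacity
(`IsStabilityDecomposition.excess_le`). Optimality of the limit is weak duality with prices `1 / q
b`; strict concavity makes the workloads unique. -/

namespace Network

variable {F B : Type*} {S : Network F B}

/-! ### Service rate functions and their tangents -/

namespace Admissible

theorem mu_continuousOn (hS : S.Admissible) (b : B) : ContinuousOn (S.mu b) (Ici 0) :=
  (hS.mu_contDiff b).continuousOn

theorem marginalRate_continuousOn (hS : S.Admissible) (b : B) :
    ContinuousOn (S.marginalRate b) (Ici 0) :=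
  (hS.mu_contDiff b).continuousOn_derivWithin (uniqueDiffOn_Ici 0) (by norm_num)

theorem hasDerivWithinAt_mu (hS : S.Admissible) (b : B) {n : ℝ} (hn : 0 ≤ n) :
    HasDerivWithinAt (S.mu b) (S.marginalRate b n) (Ici 0) n :=
  ((hS.mu_contDiff b).differentiableOn (by norm_num) n hn).hasDerivWithinAt

/-- The graph of `μ_b` lies strictly below its tangents. -/
theorem mu_lt_tangent (hS : S.Admissible) (b : B) {a n : ℝ} (ha : 0 ≤ a) (hn : 0 ≤ n)
    (han : a ≠ n) : S.mu b a < S.mu b n + S.marginalRate b n * (a - n) := by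
  rcases lt_or_gt_of_ne han with h | h
  · have := (hS.mu_strictConcave b).lt_slope_of_hasDerivWithinAt ha hn h
      (hS.hasDerivWithinAt_mu b hn)
    rw [slope_def_field, lt_div_iff₀ (sub_pos.2 h)] at this
    linarith
  · have := (hS.mu_strictConcave b).slope_lt_of_hasDerivWithinAt hn ha h
      (hS.hasDerivWithinAt_mu b hn)
    rw [slope_def_field, div_lt_iff₀ (sub_pos.2 h)] at this
    linarith

theorem mu_le_tangent (hS : S.Admissible) (b : B) {a n : ℝ} (ha : 0 ≤ a) (hn : 0 ≤ n) :
    S.mu b a ≤ S.mu b n + S.marginalRate b n * (a - n) := by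
  rcases eq_or_ne a n with rfl | h
  · simp
  · exact (hS.mu_lt_tangent b ha hn h).le

theorem marginalRate_pos (hS : S.Admissible) (b : B) {n : ℝ} (hn : 0 ≤ n) :
    0 < S.marginalRate b n := by
  have h1 := hS.mu_le_tangent b (a := n + 1) (n := n) (by linarith) hn
  have h2 := hS.mu_strictMono b (mem_Ici.2 hn) (mem_Ici.2 (by linarith : 0 ≤ n + 1))
    (lt_add_one n)
  linarith

theorem marginalRate_lt (hS : S.Admissible) (b : B) {a n : ℝ} (ha : 0 ≤ a) (h : a < n) :
    S.marginalRate b n < S.marginalRate b a := by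
  have h1 := hS.mu_lt_tangent b ha (ha.trans h.le) h.ne
  have h2 := hS.mu_lt_tangent b (ha.trans h.le) ha h.ne'
  nlinarith

theorem marginalRate_le (hS : S.Admissible) (b : B) {a n : ℝ} (ha : 0 ≤ a) (h : a ≤ n) :
    S.marginalRate b n ≤ S.marginalRate b a := by
  rcases h.eq_or_lt with rfl | h
  · exact le_rfl
  · exact (hS.marginalRate_lt b ha h).le

theorem mu_mono (hS : S.Admissible) (b : B) {a n : ℝ} (ha : 0 ≤ a) (h : a ≤ n) :
    S.mu b a ≤ S.mu b n :=
  (hS.mu_strictMono b).monotoneOn ha (ha.trans h) h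

theorem mu_nonneg (hS : S.Admissible) (b : B) {n : ℝ} (hn : 0 ≤ n) : 0 ≤ S.mu b n :=
  (hS.mu_zero b).symm.le.trans (hS.mu_mono b le_rfl hn)

theorem mu_lt_capacity (hS : S.Admissible) (b : B) {n : ℝ} (hn : 0 ≤ n) :
    S.mu b n < S.capacity b := by
  refine (hS.mu_strictMono b (mem_Ici.2 hn) (mem_Ici.2 (by linarith : 0 ≤ n + 1))
    (lt_add_one n)).trans_le ?_
  refine ge_of_tendsto (hS.tendsto_capacity b) ?_
  filter_upwards [eventually_ge_atTop (n + 1)] with m hm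
  exact hS.mu_mono b (by linarith) hm

theorem capacity_pos (hS : S.Admissible) (b : B) : 0 < S.capacity b := by
  have := hS.mu_lt_capacity b le_rfl
  rwa [hS.mu_zero] at this

/-- The tangent at `n`, evaluated at 0, gives `n * μ_b'(n) ≤ μ_b(n) < μ_b(∞)`. -/
theorem tendsto_marginalRate (hS : S.Admissible) (b : B) :
    Tendsto (S.marginalRate b) atTop (𝓝 0) := by
  have h : Tendsto (fun n : ℝ => S.capacity b / n) atTop (𝓝 0) :=
    tendsto_const_nhds.div_atTop tendsto_id
  refine tendsto_of_tendsto_of_tendsto_of_le_of_le' tendsto_const_nhds h ?_ ?_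
  · filter_upwards [eventually_ge_atTop 0] with n hn using (hS.marginalRate_pos b hn).le
  · filter_upwards [eventually_gt_atTop 0] with n hn
    have h1 := hS.mu_le_tangent b le_rfl hn.le
    have h2 := hS.mu_lt_capacity b hn.le
    rw [hS.mu_zero] at h1
    rw [le_div_iff₀ hn]
    linarith

/-- On a bounded set of workloads, `μ_b` grows at least at the smallest marginal rate. -/
theorem marginalRate_mul_le_mu_sub (hS : S.Admissible) (b : B) {a n R : ℝ} (ha : 0 ≤ a)
    (han : a ≤ n) (hR : n ≤ R) : S.marginalRate b R * (n - a) ≤ S.mu b n - S.mu b a := by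
  have h1 := hS.mu_le_tangent b ha (ha.trans han)
  have h2 := hS.marginalRate_le b (ha.trans han) hR
  nlinarith

theorem tendsto_mu (hS : S.Admissible) (b : B) {ι : Type*} {l : Filter ι} {u : ι → ℝ} {n : ℝ}
    (hu : ∀ᶠ i in l, 0 ≤ u i) (hn : 0 ≤ n) (h : Tendsto u l (𝓝 n)) :
    Tendsto (fun i => S.mu b (u i)) l (𝓝 (S.mu b n)) :=
  (hS.mu_continuousOn b n hn).tendsto.comp
    (tendsto_nhdsWithin_iff.2 ⟨h, hu⟩)

theorem tendsto_marginalRate_nhds (hS : S.Admissible) (b : B) {ι : Type*} {l : Filter ι}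
    {u : ι → ℝ} {n : ℝ} (hu : ∀ i, 0 ≤ u i) (hn : 0 ≤ n) (h : Tendsto u l (𝓝 n)) :
    Tendsto (fun i => S.marginalRate b (u i)) l (𝓝 (S.marginalRate b n)) :=
  (hS.marginalRate_continuousOn b n hn).tendsto.comp
    (tendsto_nhdsWithin_iff.2 ⟨h, Eventually.of_forall hu⟩)

end Admissible

/-! ### Uniqueness of the stability decomposition -/

open Classical in
theorem sum_lam_le_sum_lam_add (S : Network F B) (hlam : ∀ f, 0 ≤ S.lam f) (s t u : Finset F)
    (h : s ⊆ t ∪ u) : ∑ f ∈ s, S.lam f ≤ ∑ f ∈ t, S.lam f + ∑ f ∈ u, S.lam f := by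
  refine (Finset.sum_le_sum_of_subset_of_nonneg h fun f _ _ => hlam f).trans ?_
  rw [← Finset.sum_union_inter]
  exact le_add_of_nonneg_right (Finset.sum_nonneg fun f _ => hlam f)

section Decomposition

variable [Fintype F] [Fintype B]

open Classical in
/-- The set of frontends that are connected to backends in `U` only. -/
noncomputable def confined (S : Network F B) (U : Finset B) : Finset F :=
  Finset.univ.filter fun f => ∀ b, S.adj f b → b ∈ U

open Classical in
/-- The complement of the stable backends maximizes the excess of the confined arrivals over the
capacity, and it contains every other maximizer. -/
theorem IsStabilityDecomposition.excess_le (hS : S.Admissible) {Ft : Finset F} {Bt : Finset B}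
    (hD : S.IsStabilityDecomposition Ft Bt) (V : Finset B) :
    ∑ f ∈ S.confined V, S.lam f - ∑ b ∈ V, S.capacity b ≤
      ∑ f ∈ S.confined Btᶜ, S.lam f - ∑ b ∈ Btᶜ, S.capacity b ∧
    (¬ V ⊆ Btᶜ → ∑ f ∈ S.confined V, S.lam f - ∑ b ∈ V, S.capacity b <
      ∑ f ∈ S.confined Btᶜ, S.lam f - ∑ b ∈ Btᶜ, S.capacity b) := by
  -- The overload condition is used for the backends of `Btᶜ` missing from `V`, the stability
  -- condition for the frontends of `Ft` confined to `V`.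
  have hQ := hD.overloaded (Btᶜ \ V) (Finset.disjoint_left.2 fun b hb hb' => by
    simp [hb'] at hb)
  have hcap : ∑ b ∈ V, S.capacity b + ∑ b ∈ Btᶜ \ V, S.capacity b
      = ∑ b ∈ Btᶜ, S.capacity b + ∑ b ∈ V \ Btᶜ, S.capacity b := by
    rw [← Finset.sum_union Finset.disjoint_sdiff, ← Finset.sum_union Finset.disjoint_sdiff,
      Finset.union_sdiff_self_eq_union, Finset.union_sdiff_self_eq_union, Finset.union_comm]
  -- Stability is strict only for nonempty sets of frontends. For the empty set, strictness comes
  -- from the positive capacity of `V \ Btᶜ`, unless `V ⊆ Btᶜ`.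
  have hP : (∑ f ∈ Ft with (f ∈ S.confined V), S.lam f < ∑ b ∈ V \ Btᶜ, S.capacity b) ∨
      V ⊆ Btᶜ ∧ ∑ f ∈ Ft with (f ∈ S.confined V), S.lam f ≤ ∑ b ∈ V \ Btᶜ, S.capacity b := by
    rcases (Ft.filter (· ∈ S.confined V)).eq_empty_or_nonempty with h | h
    · rw [h, Finset.sum_empty]
      by_cases hVB : V ⊆ Btᶜ
      · exact Or.inr ⟨hVB, Finset.sum_nonneg fun b _ => (hS.capacity_pos b).le⟩
      · refine Or.inl (Finset.sum_pos (fun b _ => hS.capacity_pos b) ?_)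
        exact Finset.sdiff_nonempty.2 hVB
    · refine Or.inl ((hD.stable _ (Finset.filter_subset _ _) h).trans_le ?_)
      refine Finset.sum_le_sum_of_subset_of_nonneg ?_ fun b _ _ => (hS.capacity_pos b).le
      intro b hb
      simp only [Finset.mem_filter, confined, Finset.mem_univ, true_and] at hb
      obtain ⟨hb, f, ⟨_, hf⟩, hfb⟩ := hb
      simp [hb, hf b hfb]
  have h1 : ∑ f ∈ S.confined V, S.lam f
      + ∑ f with (∃ b ∈ Btᶜ \ V, S.adj f b) ∧ f ∉ Ft, S.lam f
      ≤ ∑ f ∈ Ft with (f ∈ S.confined V), S.lam f + ∑ f ∈ S.confined Btᶜ, S.lam f := by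
    rw [← Finset.sum_union]
    · refine S.sum_lam_le_sum_lam_add hS.lam_nonneg _ _ _ ?_
      intro f hf
      simp only [Finset.mem_union, Finset.mem_filter, Finset.mem_univ, true_and] at hf ⊢
      by_cases hft : f ∈ Ft
      · rcases hf with hf | hf
        · exact Or.inl ⟨hft, hf⟩
        · exact absurd hft hf.2
      · right
        simp only [confined, Finset.mem_filter, Finset.mem_univ, true_and, Finset.mem_compl]
        intro b hfb hb
        exact hft ((hD.frontends f).2 ⟨b, hb, hfb⟩)
    · refine Finset.disjoint_left.2 fun f hf hf' => ?_
      simp only [confined, Finset.mem_filter, Finset.mem_univ, true_and, Finset.mem_sdiff]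
        at hf hf'
      obtain ⟨⟨b, hb, hfb⟩, _⟩ := hf'
      exact hb.2 (hf b hfb)
  rcases hP with hP | ⟨hVB, hP⟩
  · exact ⟨by linarith, fun _ => by linarith⟩
  · exact ⟨by linarith, fun h => absurd hVB h⟩

theorem IsStabilityDecomposition.unique (hS : S.Admissible) {Ft Ft' : Finset F}
    {Bt Bt' : Finset B} (hD : S.IsStabilityDecomposition Ft Bt)
    (hD' : S.IsStabilityDecomposition Ft' Bt') : Ft = Ft' ∧ Bt = Bt' := by
  classical
  have hB : Bt = Bt' := by
    rw [← compl_inj_iff]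
    refine Finset.Subset.antisymm ?_ ?_
    · by_contra h
      exact ((hD'.excess_le hS _).2 h).not_ge (hD.excess_le hS _).1
    · by_contra h
      exact ((hD.excess_le hS _).2 h).not_ge (hD'.excess_le hS _).1
  subst hB
  refine ⟨?_, rfl⟩
  ext f
  rw [hD.frontends, hD'.frontends]

end Decomposition

/-! ### Inverse service rates with additional departures -/

/-- With additional departures at rate `ε n`, a service rate function has a continuous inverse. -/
theorem Admissible.exists_inverse (hS : S.Admissible) {ε : ℝ} (hε : 0 < ε) (b : B) :
    ∃ g : ℝ → ℝ, Continuous g ∧ StrictMono g ∧ ∀ a, 0 ≤ a → 0 ≤ g a ∧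
      S.mu b (g a) + ε * g a = a := by
  -- The values of `S.mu b` at negative arguments are arbitrary; `max n 0` replaces them, so that
  -- `φ` is a bijection of the line.
  let φ : ℝ → ℝ := fun n => S.mu b (max n 0) + ε * n
  have hmono : StrictMono φ := fun m n hmn => by
    have h1 := hS.mu_mono b (le_max_right m 0) (max_le_max_right 0 hmn.le)
    have h2 := mul_lt_mul_of_pos_left hmn hε
    simp only [φ]; linarith
  have hcont : Continuous φ := by
    have : Continuous fun n : ℝ => S.mu b (max n 0) :=
      (hS.mu_continuousOn b).comp_continuous (by fun_prop) fun n => le_max_right n 0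
    fun_prop
  have htop : Tendsto φ atTop atTop := by
    refine tendsto_atTop_mono (f := fun n => ε * n) (fun n => ?_)
      (tendsto_id.const_mul_atTop hε)
    have := hS.mu_nonneg b (le_max_right n 0)
    simp only [φ]; linarith
  have hbot : Tendsto φ atBot atBot := by
    refine tendsto_atBot_mono (f := fun n => S.capacity b + ε * n) (fun n => ?_)
      (tendsto_atBot_add_const_left _ _ (tendsto_id.const_mul_atBot hε))
    have := hS.mu_lt_capacity b (le_max_right n 0)
    simp only [φ]; linarith
  let e := hmono.orderIsoOfSurjective φ (hcont.surjective htop hbot)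
  have he : ∀ a, φ (e.symm a) = a := fun a => e.apply_symm_apply a
  refine ⟨e.symm, e.symm.continuous, e.symm.strictMono, fun a ha => ?_⟩
  have h0 : 0 ≤ e.symm a := by
    rw [← hmono.le_iff_le, he]
    simpa [φ, hS.mu_zero] using ha
  refine ⟨h0, ?_⟩
  have := he a
  simp only [φ, max_eq_left h0] at this
  exact this

/-! ### Routing vectors and greedy routings -/

section Routing

variable [Fintype B]

theorem routing_nonneg {f : F} {y : B → ℝ} (hy : y ∈ S.routing f) (b : B) : 0 ≤ y b := by
  by_cases h : S.adj f b
  · exact hy.2.1 b h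
  · exact (hy.2.2 b h).ge

theorem adj_of_routing_pos {f : F} {y : B → ℝ} (hy : y ∈ S.routing f) {b : B} (h : 0 < y b) :
    S.adj f b := by
  by_contra hn
  exact h.ne' (hy.2.2 b hn)

theorem routing_le_one {f : F} {y : B → ℝ} (hy : y ∈ S.routing f) (b : B) : y b ≤ 1 := by
  rw [← hy.1]
  exact Finset.single_le_sum (fun b _ => routing_nonneg hy b) (Finset.mem_univ b)

theorem isCompact_routing (S : Network F B) (f : F) : IsCompact (S.routing f) := by
  refine (isCompact_univ_pi fun _ : B => isCompact_Icc (a := (0 : ℝ)) (b := 1)).of_isClosed_subset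
    ?_ fun y hy b _ => ⟨routing_nonneg hy b, routing_le_one hy b⟩
  have : S.routing f = {y | ∑ b, y b = 1} ∩ ((⋂ b, {y | S.adj f b → 0 ≤ y b}) ∩
      ⋂ b, {y | ¬ S.adj f b → y b = 0}) := by
    ext y
    simp [routing]
  rw [this]
  refine (isClosed_eq (by fun_prop) continuous_const).inter
    ((isClosed_iInter fun b => ?_).inter (isClosed_iInter fun b => ?_))
  · by_cases h : S.adj f b
    · simpa [h] using isClosed_le continuous_const (continuous_apply b)
    · simp [h]
  · by_cases h : S.adj f b
    · simp [h]
    · simpa [h] using isClosed_eq (continuous_apply b) continuous_const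

open Classical in
theorem single_mem_routing {f : F} {b : B} (h : S.adj f b) : Pi.single b 1 ∈ S.routing f := by
  refine ⟨by simp, fun b' _ => ?_, fun b' hb' => ?_⟩
  · by_cases hb : b' = b
    · subst hb; simp
    · simp [hb]
  · have : b' ≠ b := fun e => hb' (e ▸ h)
    simp [this]

open Classical in
/-- The routing that results from moving the mass `δ` from `b` to `b'`. -/
theorem move_mem_routing {f : F} {y : B → ℝ} (hy : y ∈ S.routing f) {b b' : B} {δ : ℝ}
    (hb : S.adj f b) (hb' : S.adj f b') (hδ : 0 ≤ δ) (hδy : δ ≤ y b) :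
    y + (Pi.single b' δ - Pi.single b δ) ∈ S.routing f := by
  refine ⟨?_, fun c _ => ?_, fun c hc => ?_⟩
  · simp [Finset.sum_add_distrib, hy.1]
  · have h1 : (0 : B → ℝ) ≤ Pi.single b' δ := Pi.single_nonneg.2 hδ
    have h2 := h1 c
    have h3 := routing_nonneg hy c
    simp only [Pi.add_apply, Pi.sub_apply, Pi.zero_apply] at h2 ⊢
    by_cases hcb : c = b
    · subst hcb; simp only [Pi.single_eq_same]; linarith
    · rw [Pi.single_eq_of_ne hcb]; linarith
  · have h1 : c ≠ b := fun e => hc (e ▸ hb)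
    have h2 : c ≠ b' := fun e => hc (e ▸ hb')
    simp [h1, h2, hy.2.2 c hc]

/-- The routings `y` send jobs only to compatible backends with the greatest rate `r`. -/
structure IsGreedy (S : Network F B) (r : B → ℝ) (y : F → B → ℝ) : Prop where
  mem_routing : ∀ f, y f ∈ S.routing f
  le_of_pos : ∀ f b b', 0 < y f b → S.adj f b' → r b' ≤ r b

open Classical in
theorem exists_single_greedy (hS : S.Admissible) (r : B → ℝ) (f : F) :
    ∃ y ∈ S.routing f, ∀ b b', 0 < y b → S.adj f b' → r b' ≤ r b := by
  obtain ⟨b₀, hb₀⟩ := hS.frontend_not_isolated f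
  obtain ⟨b, hb, hmax⟩ := Finset.exists_max_image (Finset.univ.filter (S.adj f)) r
    ⟨b₀, by simpa using hb₀⟩
  refine ⟨Pi.single b 1, single_mem_routing (by simpa using hb), fun c b' hc hb' => ?_⟩
  have : c = b := by
    by_contra hne
    simp [hne] at hc
  subst this
  exact hmax b' (by simpa using hb')

end Routing

/-! ### Equilibria with additional departures -/

section Equilibrium

variable [Fintype F]

/-- The rate at which jobs arrive at backend `b` under the routings `y`. -/
def inflow (S : Network F B) (y : F → B → ℝ) (b : B) : ℝ := ∑ f, S.lam f * y f b

theorem continuous_inflow (S : Network F B) (b : B) : Continuous fun y => S.inflow y b := by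
  unfold inflow
  fun_prop

open Classical in
theorem inflow_update (S : Network F B) (y : F → B → ℝ) (f : F) (w : B → ℝ) (b : B) :
    S.inflow (Function.update y f (y f + w)) b = S.inflow y b + S.lam f * w b := by
  have : ∀ g, S.lam g * Function.update y f (y f + w) g b
      = S.lam g * y g b + if g = f then S.lam f * w b else 0 := by
    intro g
    by_cases h : g = f
    · subst h; simp; ring
    · simp [h]
  simp [inflow, this, Finset.sum_add_distrib]

variable [Fintype B]

theorem Admissible.inflow_nonneg (hS : S.Admissible) {y : F → B → ℝ}
    (hy : ∀ f, y f ∈ S.routing f) (b : B) : 0 ≤ S.inflow y b :=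
  Finset.sum_nonneg fun f _ => mul_nonneg (hS.lam_nonneg f) (routing_nonneg (hy f) b)

/-- With additional departures at rate `ε n`, the system has an equilibrium. -/
theorem Admissible.exists_equilibrium (hS : S.Admissible) {ε : ℝ} (hε : 0 < ε) :
    ∃ (M : B → ℝ) (y : F → B → ℝ), (∀ b, 0 ≤ M b) ∧
      S.IsGreedy (fun b => S.marginalRate b (M b)) y ∧
      ∀ b, S.inflow y b = S.mu b (M b) + ε * M b := by
  classical
  choose g hgc hgm hg using fun b => hS.exists_inverse hε b
  have hK : IsCompact (Set.univ.pi fun f => S.routing f) :=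
    isCompact_univ_pi fun f => S.isCompact_routing f
  have hne : (Set.univ.pi fun f => S.routing f).Nonempty := by
    choose z hz using fun f => exists_single_greedy hS 0 f
    exact ⟨z, fun f _ => (hz f).1⟩
  -- The objective is the total workload at which the perturbed system balances the inflows of `x`.
  have hGc : Continuous fun x => ∑ b, g b (S.inflow x b) :=
    continuous_finsetSum _ fun b _ => (hgc b).comp (S.continuous_inflow b)
  obtain ⟨x, hxK, hx⟩ := hK.exists_isMinOn hne hGc.continuousOn
  have hxr : ∀ f, x f ∈ S.routing f := fun f => hxK f (mem_univ f)
  have hI := hS.inflow_nonneg hxr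
  set M : B → ℝ := fun b => g b (S.inflow x b) with hM
  have hM0 : ∀ b, 0 ≤ M b := fun b => (hg b _ (hI b)).1
  have key : ∀ f, 0 < S.lam f → ∀ b b', 0 < x f b → S.adj f b' →
      S.marginalRate b' (M b') ≤ S.marginalRate b (M b) := by
    intro f hf b b' hb hb'
    by_cases hbb : b = b'
    · subst hbb; exact le_rfl
    have hadj := adj_of_routing_pos (hxr f) hb
    -- Moving the mass `δ` from `b` to `b'` cannot lower the total workload. Rates are taken at the
    -- workloads after the move, where the tangents bound both changes in the useful direction.
    have hineq : ∀ δ, 0 < δ → δ ≤ x f b →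
        S.marginalRate b' (g b' (S.inflow x b' + S.lam f * δ)) ≤
          S.marginalRate b (g b (S.inflow x b - S.lam f * δ)) := by
      intro δ hδ hδx
      set w : B → ℝ := Pi.single b' δ - Pi.single b δ with hw
      have hwb : w b = -δ := by simp [hw, hbb]
      have hwb' : w b' = δ := by simp [hw, Ne.symm hbb]
      have hmem : Function.update x f (x f + w) ∈ Set.univ.pi fun f => S.routing f := by
        intro f' _
        by_cases hff : f' = f
        · subst hff
          simpa using move_mem_routing (hxr f') hadj hb' hδ.le hδx
        · simpa [hff] using hxr f'
      have hmin := hx hmem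
      simp only [mem_ofPred_eq, inflow_update] at hmin
      have hbI : S.lam f * δ ≤ S.inflow x b := by
        have : S.lam f * x f b ≤ S.inflow x b :=
          Finset.single_le_sum (f := fun f => S.lam f * x f b) (fun f' _ =>
            mul_nonneg (hS.lam_nonneg f') (routing_nonneg (hxr f') b)) (Finset.mem_univ f)
        exact (mul_le_mul_of_nonneg_left hδx hf.le).trans this
      have hdiff : ∑ c, (g c (S.inflow x c + S.lam f * w c) - g c (S.inflow x c))
          = (g b (S.inflow x b - S.lam f * δ) - g b (S.inflow x b))
            + (g b' (S.inflow x b' + S.lam f * δ) - g b' (S.inflow x b')) := by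
        rw [← Finset.sum_subset (Finset.subset_univ {b, b'}), Finset.sum_pair hbb, hwb, hwb']
        · rw [mul_neg, ← sub_eq_add_neg]
        · intro c _ hc
          simp only [Finset.mem_insert, Finset.mem_singleton, not_or] at hc
          simp [hw, hc.1, hc.2]
      rw [Finset.sum_sub_distrib] at hdiff
      have hη : 0 < S.lam f * δ := mul_pos hf hδ
      obtain ⟨hn0, hn⟩ := hg b (S.inflow x b - S.lam f * δ) (by linarith)
      obtain ⟨hm0, hm⟩ := hg b' (S.inflow x b' + S.lam f * δ) (by linarith [hI b'])
      obtain ⟨hb0, hbe⟩ := hg b _ (hI b)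
      obtain ⟨hb0', hbe'⟩ := hg b' _ (hI b')
      have hlt := hgm b (show S.inflow x b - S.lam f * δ < S.inflow x b by linarith)
      have hlt' := hgm b' (show S.inflow x b' < S.inflow x b' + S.lam f * δ by linarith)
      have ht := hS.mu_le_tangent b hb0 hn0
      have ht' := hS.mu_le_tangent b' hb0' hm0
      have hpos := hS.marginalRate_pos b hn0
      by_contra! hcon
      generalize g b (S.inflow x b - S.lam f * δ) = n at *
      generalize g b' (S.inflow x b' + S.lam f * δ) = m at *
      generalize g b (S.inflow x b) = n₀ at *
      generalize g b' (S.inflow x b') = m₀ at *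
      generalize S.marginalRate b n = p at *
      generalize S.marginalRate b' m = p' at *
      -- Both sides are compared with the moved flow `S.lam f * δ`.
      have h1 : (p' + ε) * (m - m₀) ≤ (p + ε) * (n₀ - n) := by linarith
      have h2 : n₀ - n ≤ m - m₀ := by linarith
      have h3 : (p + ε) * (n₀ - n) ≤ (p + ε) * (m - m₀) :=
        mul_le_mul_of_nonneg_left h2 (by linarith)
      have h4 : (p + ε) * (m - m₀) < (p' + ε) * (m - m₀) :=
        mul_lt_mul_of_pos_right (by linarith) (by linarith)
      linarith
    have hlim : ∀ c, ∀ s : ℝ, (∀ᶠ δ in 𝓝[>] (0 : ℝ), 0 ≤ g c (S.inflow x c + s * δ)) →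
        Tendsto (fun δ => S.marginalRate c (g c (S.inflow x c + s * δ))) (𝓝[>] 0)
          (𝓝 (S.marginalRate c (M c))) := by
      intro c s hev
      refine (hS.marginalRate_continuousOn c _ (hM0 c)).tendsto.comp
        (tendsto_nhdsWithin_iff.2 ⟨?_, hev⟩)
      have : Continuous fun δ => g c (S.inflow x c + s * δ) := (hgc c).comp (by fun_prop)
      have h := this.tendsto 0
      simp only [mul_zero, add_zero] at h
      exact h.mono_left nhdsWithin_le_nhds
    have hsmall : ∀ᶠ δ in 𝓝[>] (0 : ℝ), 0 < δ ∧ δ ≤ x f b :=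
      Ioc_mem_nhdsGT hb
    have hbx : S.lam f * x f b ≤ S.inflow x b :=
      Finset.single_le_sum (f := fun f => S.lam f * x f b) (fun f' _ =>
        mul_nonneg (hS.lam_nonneg f') (routing_nonneg (hxr f') b)) (Finset.mem_univ f)
    refine le_of_tendsto_of_tendsto (hlim b' (S.lam f) ?_) (hlim b (-S.lam f) ?_) ?_
    · filter_upwards [hsmall] with δ hδ
      exact (hg b' _ (add_nonneg (hI b') (mul_pos hf hδ.1).le)).1
    · filter_upwards [hsmall] with δ hδ
      refine (hg b _ ?_).1
      have := mul_le_mul_of_nonneg_left hδ.2 hf.le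
      linarith
    · filter_upwards [hsmall] with δ hδ
      rw [neg_mul, ← sub_eq_add_neg]
      exact hineq δ hδ.1 hδ.2
  -- Minimality says nothing about frontends without arrivals. They are rerouted greedily, which
  -- leaves the inflows unchanged.
  choose z hz hz' using fun f => exists_single_greedy hS (fun b => S.marginalRate b (M b)) f
  refine ⟨M, fun f => if 0 < S.lam f then x f else z f, hM0, ⟨fun f => ?_, fun f => ?_⟩,
    fun b => ?_⟩
  · split_ifs
    · exact hxr f
    · exact hz f
  · split_ifs with hf
    · exact key f hf
    · exact hz' f
  · rw [(hg b _ (hI b)).2]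
    refine Finset.sum_congr rfl fun f _ => ?_
    beta_reduce
    split_ifs with hf
    · rfl
    · simp [le_antisymm (not_lt.1 hf) (hS.lam_nonneg f)]

end Equilibrium

/-! ### Extended equilibria: stability decomposition and optimality -/

section Limit

variable [Fintype F] [Fintype B]

/-- An equilibrium in which the backends outside `W` have infinite workload. The vector `n`
consists of the workloads and `q` of the marginal rates. -/
structure IsExtendedEquilibrium (S : Network F B) (W : Finset B) (n q : B → ℝ)
    (y : F → B → ℝ) : Prop where
  nonneg : ∀ b, 0 ≤ n b
  rate_mem : ∀ b ∈ W, q b = S.marginalRate b (n b)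
  rate_notMem : ∀ b, b ∉ W → q b = 0
  greedy : S.IsGreedy q y
  inflow_mem : ∀ b ∈ W, S.inflow y b = S.mu b (n b)
  inflow_notMem : ∀ b, b ∉ W → S.capacity b ≤ S.inflow y b

/-- There is an extended equilibrium that is approximated by finite workloads at which the arrivals
are at least the service rates. -/
theorem Admissible.exists_extendedEquilibrium (hS : S.Admissible) :
    ∃ (W : Finset B) (n q : B → ℝ) (y : F → B → ℝ) (M : ℕ → B → ℝ) (z : ℕ → F → B → ℝ),
      S.IsExtendedEquilibrium W n q y ∧
      (∀ k b, 0 ≤ M k b) ∧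
      (∀ k, S.IsGreedy (fun b => S.marginalRate b (M k b)) (z k)) ∧
      (∀ k b, S.mu b (M k b) ≤ S.inflow (z k) b) ∧
      (∀ b ∈ W, Tendsto (fun k => M k b) atTop (𝓝 (n b))) ∧
      (∀ b, b ∉ W → Tendsto (fun k => M k b) atTop atTop) := by
  classical
  have hε : ∀ k : ℕ, (0 : ℝ) < 1 / ((k : ℝ) + 1) := fun k => by positivity
  choose M' z' hM0' hz' hI' using fun k : ℕ => hS.exists_equilibrium (hε k)
  -- Workloads may diverge, so the limit is taken in the compact space of `ENNReal`-valued vectors.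
  have hK : IsCompact ((univ : Set (B → ENNReal)) ×ˢ (Set.univ.pi fun f => S.routing f)) :=
    isCompact_univ.prod (isCompact_univ_pi fun f => S.isCompact_routing f)
  obtain ⟨⟨L, y⟩, hL, φ, hφ, hlim⟩ := hK.tendsto_subseq
    (x := fun k => ((fun b => ENNReal.ofReal (M' k b)), z' k))
    (fun k => ⟨mem_univ _, fun f _ => (hz' k).mem_routing f⟩)
  rw [nhds_prod_eq] at hlim
  have hlimM : ∀ b, Tendsto (fun k => ENNReal.ofReal (M' (φ k) b)) atTop (𝓝 (L b)) := fun b =>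
    (tendsto_pi_nhds.1 (tendsto_fst.comp hlim)) b
  have hlimz : Tendsto (fun k => z' (φ k)) atTop (𝓝 y) := tendsto_snd.comp hlim
  have hyr : ∀ f, y f ∈ S.routing f := fun f => hL.2 f (mem_univ f)
  set W : Finset B := Finset.univ.filter fun b => L b ≠ ⊤ with hW
  set n : B → ℝ := fun b => (L b).toReal with hn
  have hn0 : ∀ b, 0 ≤ n b := fun b => ENNReal.toReal_nonneg
  have hMW : ∀ b ∈ W, Tendsto (fun k => M' (φ k) b) atTop (𝓝 (n b)) := by
    intro b hb
    have h := (ENNReal.tendsto_toReal (by simpa [hW] using hb)).comp (hlimM b)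
    exact h.congr fun k => ENNReal.toReal_ofReal (hM0' _ _)
  have hMV : ∀ b, b ∉ W → Tendsto (fun k => M' (φ k) b) atTop atTop := by
    intro b hb
    have h := hlimM b
    rw [show L b = ⊤ by simpa [hW] using hb] at h
    exact ENNReal.tendsto_ofReal_nhds_top.1 h
  set q : B → ℝ := fun b => if b ∈ W then S.marginalRate b (n b) else 0 with hq
  have hqlim : ∀ b, Tendsto (fun k => S.marginalRate b (M' (φ k) b)) atTop (𝓝 (q b)) := by
    intro b
    by_cases hb : b ∈ W
    · simp only [hq, if_pos hb]
      exact hS.tendsto_marginalRate_nhds b (fun k => hM0' _ b) (hn0 b) (hMW b hb)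
    · simp only [hq, if_neg hb]
      exact (hS.tendsto_marginalRate b).comp (hMV b hb)
  have hIlim : ∀ b, Tendsto (fun k => S.inflow (z' (φ k)) b) atTop (𝓝 (S.inflow y b)) := fun b =>
    ((S.continuous_inflow b).tendsto y).comp hlimz
  have hεlim : Tendsto (fun k => 1 / ((φ k : ℕ) + 1 : ℝ)) atTop (𝓝 0) :=
    tendsto_one_div_add_atTop_nhds_zero_nat.comp hφ.tendsto_atTop
  have hsub : ∀ k b, S.mu b (M' k b) ≤ S.inflow (z' k) b := fun k b => by
    rw [hI' k b]
    exact le_add_of_nonneg_right (mul_nonneg (hε k).le (hM0' k b))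
  refine ⟨W, n, q, y, fun k => M' (φ k), fun k => z' (φ k), ⟨hn0, fun b hb => if_pos hb,
    fun b hb => if_neg hb, ⟨hyr, fun f b b' hb hb' => ?_⟩, fun b hb => ?_, fun b hb => ?_⟩,
    fun k => hM0' _, fun k => hz' _, fun k => hsub _, hMW, hMV⟩
  · refine le_of_tendsto_of_tendsto (hqlim b') (hqlim b) ?_
    have h : Tendsto (fun k => z' (φ k) f b) atTop (𝓝 (y f b)) :=
      tendsto_pi_nhds.1 (tendsto_pi_nhds.1 hlimz f) b
    filter_upwards [h.eventually_const_lt hb] with k hk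
    exact (hz' (φ k)).le_of_pos f b b' hk hb'
  · refine tendsto_nhds_unique (hIlim b) ?_
    have h := (hS.tendsto_mu b (Eventually.of_forall fun k => hM0' (φ k) b) (hn0 b) (hMW b hb)).add
      (hεlim.mul (hMW b hb))
    rw [zero_mul, add_zero] at h
    exact h.congr fun k => (hI' _ b).symm
  -- Here `ε` times the workload need not vanish in the limit, so only an inequality survives.
  · exact le_of_tendsto_of_tendsto' ((hS.tendsto_capacity b).comp (hMV b hb)) (hIlim b)
      fun k => hsub _ b

namespace IsExtendedEquilibrium

variable {W : Finset B} {n q : B → ℝ} {y : F → B → ℝ}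

theorem rate_pos (hS : S.Admissible) (hE : S.IsExtendedEquilibrium W n q y) {b : B}
    (hb : b ∈ W) : 0 < q b := by
  rw [hE.rate_mem b hb]
  exact hS.marginalRate_pos b (hE.nonneg b)

/-- Rates are positive on `W` and zero elsewhere, so a greedy frontend with a neighbour in `W` never
leaves `W`. -/
theorem eq_zero (hS : S.Admissible) (hE : S.IsExtendedEquilibrium W n q y) {f : F} {b b' : B}
    (hb : b ∈ W) (hfb : S.adj f b) (hb' : b' ∉ W) : y f b' = 0 := by
  by_contra hne
  have hpos := lt_of_le_of_ne (routing_nonneg (hE.greedy.mem_routing f) b') (Ne.symm hne)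
  have := hE.greedy.le_of_pos f b' b hpos hfb
  rw [hE.rate_notMem b' hb'] at this
  exact this.not_gt (hE.rate_pos hS hb)

theorem sum_mem (hS : S.Admissible) (hE : S.IsExtendedEquilibrium W n q y) {f : F} {b : B}
    (hb : b ∈ W) (hfb : S.adj f b) : ∑ c ∈ W, y f c = 1 := by
  rw [← (hE.greedy.mem_routing f).1]
  exact Finset.sum_subset (Finset.subset_univ _) fun c _ hc => hE.eq_zero hS hb hfb hc

-- Frontends adjacent to `W` send all arrivals into `W`, where the inflow is a service rate at
-- finite workload, hence below capacity. Backends outside `W` receive at least their capacity, and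
-- only the other frontends contribute to it.
open Classical in
theorem isStabilityDecomposition (hS : S.Admissible) (hE : S.IsExtendedEquilibrium W n q y) :
    S.IsStabilityDecomposition (Finset.univ.filter fun f => ∃ b ∈ W, S.adj f b) W where
  frontends f := by simp
  stable P hP hPne := by
    have hmem : ∀ f ∈ P, ∃ b ∈ W, S.adj f b := fun f hf => by simpa using hP hf
    have hle : ∑ f ∈ P, S.lam f ≤ ∑ b ∈ W with ∃ f ∈ P, S.adj f b, S.inflow y b := by
      have h1 : ∀ f ∈ P, S.lam f = ∑ b ∈ W with ∃ f ∈ P, S.adj f b, S.lam f * y f b := by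
        intro f hf
        obtain ⟨b, hb, hfb⟩ := hmem f hf
        rw [← Finset.mul_sum, Finset.sum_filter_of_ne, hE.sum_mem hS hb hfb, mul_one]
        intro c _ hc
        refine ⟨f, hf, ?_⟩
        by_contra hn
        exact hc ((hE.greedy.mem_routing f).2.2 c hn)
      rw [Finset.sum_congr rfl h1, Finset.sum_comm]
      refine Finset.sum_le_sum fun b _ => ?_
      exact Finset.sum_le_sum_of_subset_of_nonneg (Finset.subset_univ _) fun f _ _ =>
        mul_nonneg (hS.lam_nonneg f) (routing_nonneg (hE.greedy.mem_routing f) b)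
    refine hle.trans_lt (Finset.sum_lt_sum_of_nonempty ?_ fun b hb => ?_)
    · obtain ⟨f, hf⟩ := hPne
      obtain ⟨b, hb, hfb⟩ := hmem f hf
      exact ⟨b, by simpa using ⟨hb, f, hf, hfb⟩⟩
    · rw [hE.inflow_mem b (Finset.mem_filter.1 hb).1]
      exact hS.mu_lt_capacity b (hE.nonneg b)
  overloaded Q hQ := by
    have hQ' : ∀ b ∈ Q, b ∉ W := fun b hb => Finset.disjoint_left.1 hQ hb
    refine (Finset.sum_le_sum fun b hb => hE.inflow_notMem b (hQ' b hb)).trans ?_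
    simp only [inflow]
    rw [Finset.sum_comm, Finset.sum_filter]
    refine Finset.sum_le_sum fun f _ => ?_
    have hr := hE.greedy.mem_routing f
    rw [← Finset.mul_sum]
    split_ifs with h
    · refine mul_le_of_le_one_right (hS.lam_nonneg f) ?_
      rw [← hr.1]
      exact Finset.sum_le_sum_of_subset_of_nonneg (Finset.subset_univ _) fun b _ _ =>
        routing_nonneg hr b
    · rw [Finset.sum_eq_zero, mul_zero]
      intro b hb
      by_contra hne
      have hfb : S.adj f b := by
        by_contra hn
        exact hne (hr.2.2 b hn)
      refine h ⟨⟨b, hb, hfb⟩, fun hf => ?_⟩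
      obtain ⟨c, hc, hfc⟩ := (Finset.mem_filter.1 hf).2
      exact hne (hE.eq_zero hS hc hfc (hQ' b hb))

/-- A frontend has the least cost `∑ b, x b / q b` under the routing of an equilibrium. -/
theorem sum_div_le (hS : S.Admissible) (hE : S.IsExtendedEquilibrium W n q y) {Ft : Finset F}
    (hFt : ∀ f, f ∈ Ft ↔ ∃ b ∈ W, S.adj f b) (f : {f // f ∈ Ft}) {x : {b // b ∈ W} → ℝ}
    (hx : x ∈ (S.restrict Ft W).routing f) :
    ∑ b : {b // b ∈ W}, y f b / q b ≤ ∑ b : {b // b ∈ W}, x b / q b := by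
  obtain ⟨b₀, hb₀, hfb₀⟩ := (hFt f).1 f.2
  have hy1 : ∑ b : {b // b ∈ W}, y f b = 1 := by
    rw [Finset.sum_coe_sort W (fun b => y f b)]
    exact hE.sum_mem hS hb₀ hfb₀
  -- `q c` is the greatest rate available to `f`, so `1 / q c` is its least unit cost.
  obtain ⟨c, hc⟩ : ∃ c : {b // b ∈ W}, 0 < y f c := by
    by_contra! h
    have := Finset.sum_nonpos fun (c : {b // b ∈ W}) (_ : c ∈ Finset.univ) => h c
    linarith
  have hup : ∀ b : {b // b ∈ W}, y f b / q b ≤ y f b * (1 / q c) := by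
    intro b
    rw [div_eq_mul_one_div]
    rcases (routing_nonneg (hE.greedy.mem_routing f) b).eq_or_lt with h | h
    · rw [← h]; simp
    · refine mul_le_mul_of_nonneg_left ?_ h.le
      exact one_div_le_one_div_of_le (hE.rate_pos hS c.2) (hE.greedy.le_of_pos f b c h
        (adj_of_routing_pos (hE.greedy.mem_routing f) hc))
  have hlow : ∀ b : {b // b ∈ W}, x b * (1 / q c) ≤ x b / q b := by
    intro b
    rw [div_eq_mul_one_div (x b)]
    rcases (routing_nonneg hx b).eq_or_lt with h | h
    · rw [← h]; simp
    · refine mul_le_mul_of_nonneg_left ?_ h.le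
      exact one_div_le_one_div_of_le (hE.rate_pos hS b.2) (hE.greedy.le_of_pos f c b hc
        (adj_of_routing_pos hx h))
  refine (Finset.sum_le_sum fun b _ => hup b).trans
    (le_trans ?_ (Finset.sum_le_sum fun b _ => hlow b))
  rw [← Finset.sum_mul, ← Finset.sum_mul, hy1, hx.1]

theorem fluidFeasible (hS : S.Admissible) (hE : S.IsExtendedEquilibrium W n q y) {Ft : Finset F}
    (hFt : ∀ f, f ∈ Ft ↔ ∃ b ∈ W, S.adj f b) :
    (S.restrict Ft W).FluidFeasible (fun b => n b) (fun f b => y f b) where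
  workload_nonneg b := hE.nonneg b
  balance b := by
    refine Eq.trans ?_ (hE.inflow_mem b b.2)
    change ∑ f : {f // f ∈ Ft}, S.lam f * y f b = _
    rw [Finset.sum_coe_sort Ft (fun f => S.lam f * y f b)]
    refine Finset.sum_subset (Finset.subset_univ _) fun f _ hf => ?_
    rw [(hE.greedy.mem_routing f).2.2 b fun h => hf ((hFt f).2 ⟨b, b.2, h⟩), mul_zero]
  sum_eq_one f := by
    obtain ⟨b, hb, hfb⟩ := (hFt f).1 f.2
    rw [Finset.sum_coe_sort W (fun b => y f b)]
    exact hE.sum_mem hS hb hfb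
  nonneg f b _ := routing_nonneg (hE.greedy.mem_routing f) b
  support f b h := (hE.greedy.mem_routing f).2.2 b h

/-- Weak duality: by the tangent at `n b`, `N' b - n b` is at least `(μ_b(N' b) - μ_b(n b)) / q b`,
strictly unless the workloads agree. By flow balance these quotients sum to the difference of the
routing costs, which is nonnegative by `sum_div_le`. -/
theorem sum_le_sum (hS : S.Admissible) (hE : S.IsExtendedEquilibrium W n q y) {Ft : Finset F}
    (hFt : ∀ f, f ∈ Ft ↔ ∃ b ∈ W, S.adj f b) {N' : {b // b ∈ W} → ℝ}
    {x' : {f // f ∈ Ft} → {b // b ∈ W} → ℝ} (h : (S.restrict Ft W).FluidFeasible N' x') :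
    ∑ b : {b // b ∈ W}, n b ≤ ∑ b, N' b ∧
      (∑ b, N' b ≤ ∑ b : {b // b ∈ W}, n b → N' = fun b : {b // b ∈ W} => n b) := by
  have hy := hE.fluidFeasible hS hFt
  have hcost : 0 ≤ ∑ b : {b // b ∈ W}, (S.mu b (N' b) - S.mu b (n b)) / q b := by
    have h1 : ∀ b : {b // b ∈ W}, (S.mu b (N' b) - S.mu b (n b)) / q b
        = ∑ f : {f // f ∈ Ft}, S.lam f * (x' f b / q b - y f b / q b) := by
      intro b
      have e1 : ∑ f : {f // f ∈ Ft}, S.lam f * x' f b = S.mu b (N' b) := h.balance b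
      have e2 : ∑ f : {f // f ∈ Ft}, S.lam f * y f b = S.mu b (n b) := hy.balance b
      rw [← e1, ← e2, ← Finset.sum_sub_distrib, Finset.sum_div]
      refine Finset.sum_congr rfl fun f _ => ?_
      ring
    rw [Finset.sum_congr rfl fun b _ => h1 b, Finset.sum_comm]
    refine Finset.sum_nonneg fun f _ => ?_
    rw [← Finset.mul_sum, Finset.sum_sub_distrib]
    exact mul_nonneg (hS.lam_nonneg f) (sub_nonneg.2 (hE.sum_div_le hS hFt f
      ⟨h.sum_eq_one f, h.nonneg f, h.support f⟩))
  have hle : ∀ b : {b // b ∈ W}, (S.mu b (N' b) - S.mu b (n b)) / q b ≤ N' b - n b := by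
    intro b
    rw [div_le_iff₀ (hE.rate_pos hS b.2), hE.rate_mem b b.2]
    have := hS.mu_le_tangent b (h.workload_nonneg b) (hE.nonneg b)
    linarith
  have hlt : ∀ b : {b // b ∈ W}, N' b ≠ n b →
      (S.mu b (N' b) - S.mu b (n b)) / q b < N' b - n b := by
    intro b hb
    rw [div_lt_iff₀ (hE.rate_pos hS b.2), hE.rate_mem b b.2]
    have := hS.mu_lt_tangent b (h.workload_nonneg b) (hE.nonneg b) hb
    linarith
  constructor
  · have := hcost.trans (Finset.sum_le_sum fun b _ => hle b)
    rw [Finset.sum_sub_distrib] at this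
    linarith
  · intro hN
    by_contra hne
    obtain ⟨b, hb⟩ := Function.ne_iff.1 hne
    have := hcost.trans_lt (Finset.sum_lt_sum (fun b _ => hle b) ⟨b, Finset.mem_univ b, hlt b hb⟩)
    rw [Finset.sum_sub_distrib] at this
    linarith

end IsExtendedEquilibrium

end Limit

end Network

/-! ### Absolutely continuous functions and draining of positive parts -/

section AbsoluteContinuity

theorem AbsolutelyContinuousOnInterval.of_dist_le {X Y : Type*} [PseudoMetricSpace X]
    [PseudoMetricSpace Y] {f : ℝ → X} {g : ℝ → Y} {a b : ℝ}
    (hf : AbsolutelyContinuousOnInterval f a b) (h : ∀ s t, dist (g s) (g t) ≤ dist (f s) (f t)) :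
    AbsolutelyContinuousOnInterval g a b :=
  squeeze_zero (fun _ => Finset.sum_nonneg fun _ _ => dist_nonneg)
    (fun _ => Finset.sum_le_sum fun _ _ => h _ _) hf

theorem AbsolutelyContinuousOnInterval.const {X : Type*} [PseudoMetricSpace X] (x : X) (a b : ℝ) :
    AbsolutelyContinuousOnInterval (fun _ : ℝ => x) a b :=
  (LipschitzOnWith.absolutelyContinuousOnInterval (K := 0)
    (LipschitzWith.const x).lipschitzOnWith)

theorem AbsolutelyContinuousOnInterval.finset_sum {ι : Type*} {f : ι → ℝ → ℝ} {a b : ℝ}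
    (s : Finset ι) (h : ∀ i ∈ s, AbsolutelyContinuousOnInterval (f i) a b) :
    AbsolutelyContinuousOnInterval (fun t => ∑ i ∈ s, f i t) a b := by
  classical
  induction s using Finset.induction_on with
  | empty => simpa using AbsolutelyContinuousOnInterval.const (0 : ℝ) a b
  | insert i s hi ih =>
    simp only [Finset.sum_insert hi]
    exact (h i (Finset.mem_insert_self i s)).fun_add
      (ih fun j hj => h j (Finset.mem_insert_of_mem hj))

theorem AbsolutelyContinuousOnInterval.sub_le_of_ae_deriv_le {f : ℝ → ℝ} {s t k : ℝ}
    (hf : AbsolutelyContinuousOnInterval f s t) (hst : s ≤ t)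
    (h : ∀ᵐ x, s < x → x ≤ t → deriv f x ≤ k) : f t - f s ≤ k * (t - s) := by
  rw [← hf.integral_deriv_eq_sub]
  calc ∫ x in s..t, deriv f x ≤ ∫ _ in s..t, k := by
        rw [intervalIntegral.integral_of_le hst, intervalIntegral.integral_of_le hst]
        refine setIntegral_mono_on_ae ?_ ?_ measurableSet_Ioc ?_
        · exact (intervalIntegrable_iff_integrableOn_Ioc_of_le hst).1 hf.intervalIntegrable_deriv
        · exact (intervalIntegrable_iff_integrableOn_Ioc_of_le hst).1 intervalIntegrable_const
        · filter_upwards [h] with x hx hxs using hx hxs.1 hxs.2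
    _ = k * (t - s) := by rw [intervalIntegral.integral_const, smul_eq_mul, mul_comm]

/-- The derivative of the positive part vanishes where the function is not positive. -/
theorem deriv_posPart_le {u : ℝ → ℝ} {v t : ℝ} (hu : HasDerivAt u v t) :
    deriv (fun s => max (u s) 0) t = if 0 < u t then v else 0 := by
  split_ifs with h
  · refine HasDerivAt.deriv (hu.congr_of_eventuallyEq ?_)
    filter_upwards [hu.continuousAt.eventually_const_lt h] with s hs
    exact max_eq_left hs.le
  -- The positive part has its minimum 0 at `t`; if it has a kink there, `deriv` is 0 by default.
  · refine IsLocalMin.deriv_eq_zero (Eventually.of_forall fun s => ?_)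
    beta_reduce
    rw [max_eq_right (not_lt.1 h)]
    exact le_max_right _ _

open Classical in
/-- Functions whose positive parts are drained in total at a positive rate tend to `(-∞, 0]`. -/
theorem tendsto_posPart_zero {ι : Type*} (W : Finset ι) (u k : ℝ → ι → ℝ)
    (hAC : ∀ b ∈ W, ∀ T, 0 ≤ T → AbsolutelyContinuousOnInterval (fun t => u t b) 0 T)
    (hd : ∀ᵐ t : ℝ, 0 < t → ∃ v : ι → ℝ, (∀ b ∈ W, HasDerivAt (fun t => u t b) (v b) t) ∧
      ∑ b ∈ W with 0 < u t b, v b ≤ -∑ b ∈ W with 0 < u t b, k t b)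
    (hk : ∀ b ∈ W, ∀ R, ∃ c, 0 < c ∧ ∀ t, 0 ≤ t → 0 < u t b → u t b ≤ R → c * u t b ≤ k t b) :
    ∀ b ∈ W, Tendsto (fun t => max (u t b) 0) atTop (𝓝 0) := by
  set Φ : ℝ → ℝ := fun t => ∑ b ∈ W, max (u t b) 0 with hΦ
  have hpAC : ∀ b ∈ W, ∀ T, 0 ≤ T → AbsolutelyContinuousOnInterval (fun t => max (u t b) 0) 0 T :=
    fun b hb T hT => (hAC b hb T hT).of_dist_le fun s t => by
      simpa [Real.dist_eq] using abs_max_sub_max_le_abs (u s b) (u t b) 0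
  have hΦAC : ∀ T, 0 ≤ T → AbsolutelyContinuousOnInterval Φ 0 T := fun T hT =>
    AbsolutelyContinuousOnInterval.finset_sum W fun b hb => hpAC b hb T hT
  have hΦ0 : ∀ t, 0 ≤ Φ t := fun t => Finset.sum_nonneg fun b _ => le_max_right _ _
  have hsum : ∀ t, Φ t = ∑ b ∈ W with 0 < u t b, u t b := by
    intro t
    rw [Finset.sum_filter]
    refine Finset.sum_congr rfl fun b _ => ?_
    split_ifs with h
    · exact max_eq_left h.le
    · exact max_eq_right (not_lt.1 h)
  -- Derivatives of `u` do not suffice at the kinks of the positive parts, so differentiability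
  -- almost everywhere comes from absolute continuity.
  have hpdiff : ∀ᵐ t : ℝ, 0 < t → ∀ b ∈ W, DifferentiableAt ℝ (fun t => max (u t b) 0) t := by
    have h : ∀ m : ℕ, ∀ b ∈ W, ∀ᵐ t : ℝ, t ∈ uIcc 0 (m : ℝ) →
        DifferentiableAt ℝ (fun t => max (u t b) 0) t :=
      fun m b hb => (hpAC b hb m m.cast_nonneg).ae_differentiableAt
    have h' : ∀ᵐ t : ℝ, ∀ m : ℕ, ∀ b ∈ W, t ∈ uIcc 0 (m : ℝ) →
        DifferentiableAt ℝ (fun t => max (u t b) 0) t :=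
      ae_all_iff.2 fun m => (Finset.eventually_all W).2 (h m)
    filter_upwards [h'] with t ht htpos b hb
    obtain ⟨m, hm⟩ := exists_nat_ge t
    exact ht m b hb (by rw [uIcc_of_le m.cast_nonneg]; exact ⟨htpos.le, hm⟩)
  have hderiv : ∀ᵐ t : ℝ, 0 < t → deriv Φ t ≤ -∑ b ∈ W with 0 < u t b, k t b := by
    filter_upwards [hd, hpdiff] with t ht ht' htpos
    obtain ⟨v, hv, hle⟩ := ht htpos
    refine le_trans (le_of_eq ?_) hle
    rw [hΦ, deriv_fun_sum (ht' htpos), Finset.sum_filter]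
    exact Finset.sum_congr rfl fun b hb => deriv_posPart_le (hv b hb)
  have hanti : ∀ s t, 0 ≤ s → s ≤ t → Φ t ≤ Φ s := by
    intro s t hs hst
    have h := ((hΦAC t (hs.trans hst)).mono (c := s) (d := t) (by
      rw [uIcc_of_le hst, uIcc_of_le (hs.trans hst)]
      exact Icc_subset_Icc_left hs)).sub_le_of_ae_deriv_le (k := 0) hst (by
        filter_upwards [hderiv] with x hx hsx _
        have hx0 := hs.trans_lt hsx
        refine (hx hx0).trans (neg_nonpos.2 (Finset.sum_nonneg fun b hb => ?_))
        obtain ⟨hb, hub⟩ := Finset.mem_filter.1 hb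
        obtain ⟨c, hc, hck⟩ := hk b hb (u x b)
        exact (mul_nonneg hc.le hub.le).trans (hck x hx0.le hub le_rfl))
    linarith
  -- As `Φ` decreases, `u t b ≤ Φ 0` for all times; this bound makes the draining constant uniform.
  obtain ⟨c, hc, hck⟩ : ∃ c, 0 < c ∧ ∀ b ∈ W, ∀ t, 0 ≤ t → 0 < u t b → c * u t b ≤ k t b := by
    have h : ∀ b ∈ W, ∀ᶠ c in 𝓝[>] (0 : ℝ), ∀ t, 0 ≤ t → 0 < u t b → c * u t b ≤ k t b := by
      intro b hb
      obtain ⟨c, hc, hck⟩ := hk b hb (Φ 0)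
      filter_upwards [Ioc_mem_nhdsGT hc] with c' hc' t ht hub
      refine (mul_le_mul_of_nonneg_right hc'.2 hub.le).trans (hck t ht hub ?_)
      refine le_trans ?_ (hanti 0 t le_rfl ht)
      exact (le_max_left _ _).trans
        (Finset.single_le_sum (f := fun b => max (u t b) 0) (fun b _ => le_max_right _ _) hb)
    obtain ⟨c, hc, hc'⟩ := (((Finset.eventually_all W).2 h).and self_mem_nhdsWithin).exists
    exact ⟨c, hc', hc⟩
  -- On `[0, T]` the derivative of `Φ` is at most `-c * Φ x ≤ -c * Φ T`.
  have hdecay : ∀ T, 0 ≤ T → Φ T ≤ Φ 0 / (1 + c * T) := by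
    intro T hT
    have h := (hΦAC T hT).sub_le_of_ae_deriv_le (k := -(c * Φ T)) hT (by
      filter_upwards [hderiv] with x hx hx0 hxT
      refine (hx hx0).trans (neg_le_neg ((mul_le_mul_of_nonneg_left
        (hanti x T hx0.le hxT) hc.le).trans ?_))
      rw [hsum, Finset.mul_sum]
      refine Finset.sum_le_sum fun b hb => ?_
      obtain ⟨hb, hub⟩ := Finset.mem_filter.1 hb
      exact hck b hb x hx0.le hub)
    have hpos : 0 < 1 + c * T := by have := mul_nonneg hc.le hT; linarith
    rw [le_div_iff₀ hpos]
    linarith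
  have hlim : Tendsto (fun T => Φ 0 / (1 + c * T)) atTop (𝓝 0) :=
    tendsto_const_nhds.div_atTop
      (tendsto_atTop_add_const_left _ _ (tendsto_id.const_mul_atTop hc))
  intro b hb
  refine tendsto_of_tendsto_of_tendsto_of_le_of_le' tendsto_const_nhds hlim
    (Eventually.of_forall fun t => le_max_right _ _) ?_
  filter_upwards [eventually_ge_atTop 0] with t ht
  exact (Finset.single_le_sum (f := fun b => max (u t b) 0)
    (fun b _ => le_max_right _ _) hb).trans (hdecay t ht)

end AbsoluteContinuity

namespace Network

variable {F B : Type*} {S : Network F B}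

/-! ### Comparison of fluid solutions with equilibria -/

section Comparison

variable [Fintype B]

/-- If a compatible backend had a larger marginal rate than a used one, moving all of the mass there
would increase the objective. -/
theorem isGreedy_of_gmsr {N : B → ℝ} {x : F → B → ℝ} (hx : ∀ f, x f ∈ S.gmsr f N) :
    S.IsGreedy (fun b => S.marginalRate b (N b)) x where
  mem_routing f := (hx f).1
  le_of_pos f b b' hb hb' := by
    classical
    obtain ⟨hr, hmax⟩ := hx f
    have hfb := adj_of_routing_pos hr hb
    have h := hmax (move_mem_routing hr hfb hb' hb.le le_rfl)
    have e : ∀ (c : B) (δ : ℝ), S.adj f c →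
        ∑ d with S.adj f d, (Pi.single c δ : B → ℝ) d * S.marginalRate d (N d)
          = δ * S.marginalRate c (N c) := by
      intro c δ hc
      rw [Finset.sum_eq_single c]
      · simp
      · intro d _ hd
        simp [hd]
      · intro hc'
        exact absurd (by simpa using hc) hc'
    simp only [mem_ofPred_eq, Pi.add_apply, Pi.sub_apply, add_mul, sub_mul,
      Finset.sum_add_distrib, Finset.sum_sub_distrib] at h
    have e1 := e b' (x f b) hb'
    have e2 := e b (x f b) hfb
    by_contra! hlt
    have h3 := mul_lt_mul_of_pos_left hlt hb
    simp only [Finset.sum_filter] at h e1 e2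
    linarith

variable [Fintype F]

/-- Backends at which the rate increases relative to all others attract more jobs in total. -/
theorem sum_inflow_le (hS : S.Admissible) {r s : B → ℝ} {x y : F → B → ℝ}
    (hx : S.IsGreedy r x) (hy : S.IsGreedy s y) (P : Finset B) (hP : ∀ b ∈ P, r b < s b)
    (hP' : ∀ b, b ∉ P → s b ≤ r b) : ∑ b ∈ P, S.inflow x b ≤ ∑ b ∈ P, S.inflow y b := by
  simp only [inflow]
  rw [Finset.sum_comm, Finset.sum_comm (s := P)]
  refine Finset.sum_le_sum fun f _ => ?_
  rw [← Finset.mul_sum, ← Finset.mul_sum]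
  refine mul_le_mul_of_nonneg_left ?_ (hS.lam_nonneg f)
  have hxr := hx.mem_routing f
  have hyr := hy.mem_routing f
  -- If `x` uses `b ∈ P` and `y` uses `c ∉ P`, then `s b ≤ s c ≤ r c ≤ r b < s b`, a contradiction.
  by_cases h : ∃ b ∈ P, 0 < x f b
  · obtain ⟨b, hb, hxb⟩ := h
    have hy1 : ∑ b ∈ P, y f b = 1 := by
      rw [← hyr.1]
      refine Finset.sum_subset (Finset.subset_univ _) fun c _ hc => ?_
      by_contra hne
      have hpos := lt_of_le_of_ne (routing_nonneg hyr c) (Ne.symm hne)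
      have h1 := hy.le_of_pos f c b hpos (adj_of_routing_pos hxr hxb)
      have h2 := hx.le_of_pos f b c hxb (adj_of_routing_pos hyr hpos)
      linarith [hP b hb, hP' c hc]
    rw [hy1, ← hxr.1]
    exact Finset.sum_le_sum_of_subset_of_nonneg (Finset.subset_univ _) fun b _ _ =>
      routing_nonneg hxr b
  · push Not at h
    exact (Finset.sum_nonpos h).trans (Finset.sum_nonneg fun b _ => routing_nonneg hyr b)

namespace IsFluidSolution

variable {N : ℝ → B → ℝ}

theorem absolutelyContinuous_apply (hN : S.IsFluidSolution N) (b : B) {T : ℝ} (hT : 0 ≤ T) :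
    AbsolutelyContinuousOnInterval (fun t => N t b) 0 T :=
  (hN.absolutelyContinuous T hT).of_dist_le fun _ _ => dist_le_pi_dist _ _ b

theorem ae_exists_greedy (hN : S.IsFluidSolution N) : ∀ᵐ t : ℝ, 0 < t → ∃ x : F → B → ℝ,
    S.IsGreedy (fun b => S.marginalRate b (N t b)) x ∧
      ∀ b, HasDerivAt (fun t => N t b) (S.inflow x b - S.mu b (N t b)) t := by
  filter_upwards [hN.inclusion] with t ht htpos
  obtain ⟨v, ⟨x, hx, hv⟩, hd⟩ := ht htpos
  refine ⟨x, isGreedy_of_gmsr hx, fun b => ?_⟩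
  have := hasDerivAt_pi.1 hd b
  rwa [hv b] at this

/-- Backends of `W` above their equilibrium workload have rates below `q`, and all other backends
have rates at least `q`, those outside `W` because `q` is 0 there. So the former receive at most
their equilibrium inflow. -/
theorem tendsto_posPart_sub_zero (hS : S.Admissible) (hN : S.IsFluidSolution N) {W : Finset B}
    {n q : B → ℝ} {y : F → B → ℝ} (hE : S.IsExtendedEquilibrium W n q y) {b : B} (hb : b ∈ W) :
    Tendsto (fun t => max (N t b - n b) 0) atTop (𝓝 0) := by
  classical
  refine tendsto_posPart_zero W (fun t b => N t b - n b)
    (fun t b => S.mu b (N t b) - S.mu b (n b)) (fun b _ T hT =>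
      (hN.absolutelyContinuous_apply b hT).of_dist_le fun s t => by simp) ?_ ?_ b hb
  · filter_upwards [hN.ae_exists_greedy] with t ht htpos
    obtain ⟨x, hx, hd⟩ := ht htpos
    refine ⟨_, fun b _ => (hd b).sub_const (n b), ?_⟩
    have h := sum_inflow_le hS hx hE.greedy (W.filter fun b => 0 < N t b - n b)
      (fun b hb => ?_) (fun b hb => ?_)
    · rw [Finset.sum_congr rfl fun b hb => hE.inflow_mem b (Finset.mem_filter.1 hb).1] at h
      rw [Finset.sum_sub_distrib, Finset.sum_sub_distrib]
      linarith
    · obtain ⟨hb, hlt⟩ := Finset.mem_filter.1 hb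
      rw [hE.rate_mem b hb]
      exact hS.marginalRate_lt b (hE.nonneg b) (sub_pos.1 hlt)
    · have h0 := hN.nonneg t htpos.le b
      by_cases hbW : b ∈ W
      · rw [hE.rate_mem b hbW]
        refine hS.marginalRate_le b h0 (not_lt.1 fun hlt => hb ?_)
        exact Finset.mem_filter.2 ⟨hbW, sub_pos.2 hlt⟩
      · rw [hE.rate_notMem b hbW]
        exact (hS.marginalRate_pos b h0).le
  · intro b _ R
    have hn := hE.nonneg b
    -- `n b + |R|` bounds the workload and is nonnegative whatever the sign of `R`.
    refine ⟨S.marginalRate b (n b + |R|), hS.marginalRate_pos b (by positivity),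
      fun t _ hpos hR => ?_⟩
    exact hS.marginalRate_mul_le_mu_sub b hn (sub_pos.1 hpos).le (by linarith [le_abs_self R])

/-- The same comparison with the roles exchanged. Only `μ_b(M b) ≤ inflow` is needed, which the
perturbed equilibria satisfy. -/
theorem tendsto_posPart_rsub_zero (hS : S.Admissible) (hN : S.IsFluidSolution N) {M : B → ℝ}
    {z : F → B → ℝ} (hM : ∀ b, 0 ≤ M b)
    (hz : S.IsGreedy (fun b => S.marginalRate b (M b)) z)
    (hMz : ∀ b, S.mu b (M b) ≤ S.inflow z b) (b : B) :
    Tendsto (fun t => max (M b - N t b) 0) atTop (𝓝 0) := by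
  classical
  refine tendsto_posPart_zero Finset.univ (fun t b => M b - N t b)
    (fun t b => S.mu b (M b) - S.mu b (N t b)) (fun b _ T hT =>
      (hN.absolutelyContinuous_apply b hT).of_dist_le fun s t => by rw [dist_sub_left]) ?_ ?_ b
      (Finset.mem_univ b)
  · filter_upwards [hN.ae_exists_greedy] with t ht htpos
    obtain ⟨x, hx, hd⟩ := ht htpos
    refine ⟨_, fun b _ => (hd b).const_sub (M b), ?_⟩
    have h := sum_inflow_le hS hz hx (Finset.univ.filter fun b => 0 < M b - N t b)
      (fun b hb => ?_) (fun b hb => ?_)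
    · have h' := Finset.sum_le_sum fun b (_ : b ∈ Finset.univ.filter fun b => 0 < M b - N t b) =>
        hMz b
      rw [Finset.sum_neg_distrib, Finset.sum_sub_distrib, Finset.sum_sub_distrib]
      linarith
    · exact hS.marginalRate_lt b (hN.nonneg t htpos.le b)
        (sub_pos.1 (Finset.mem_filter.1 hb).2)
    · refine hS.marginalRate_le b (hM b) (not_lt.1 fun hlt => hb ?_)
      exact Finset.mem_filter.2 ⟨Finset.mem_univ b, sub_pos.2 hlt⟩
  · intro b _ R
    exact ⟨S.marginalRate b (M b), hS.marginalRate_pos b (hM b), fun t ht hpos _ =>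
      hS.marginalRate_mul_le_mu_sub b (hN.nonneg t ht b) (sub_pos.1 hpos).le le_rfl⟩

end IsFluidSolution

end Comparison

end Network

/-! ### Convergence of fluid solutions -/

theorem eventually_lt_of_tendsto_posPart {v : ℝ → ℝ} {a m : ℝ} (ham : a < m)
    (h : Tendsto (fun t => max (m - v t) 0) atTop (𝓝 0)) : ∀ᶠ t in atTop, a < v t := by
  filter_upwards [h.eventually_lt_const (sub_pos.2 ham)] with t ht
  have := (le_max_left _ _).trans_lt ht
  linarith

theorem theorem4 {F B : Type*} [Fintype F] [Fintype B] (S : Network F B) (hS : S.Admissible) :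
    (∃! D : Finset F × Finset B, S.IsStabilityDecomposition D.1 D.2) ∧
    ∀ (Ft : Finset F) (Bt : Finset B), S.IsStabilityDecomposition Ft Bt →
      ∃ Nopt : {b // b ∈ Bt} → ℝ,
        (∃ x, (S.restrict Ft Bt).FluidOptimal Nopt x) ∧
        (∀ N' x', (S.restrict Ft Bt).FluidOptimal N' x' → N' = Nopt) ∧
        ∀ N : ℝ → B → ℝ, S.IsFluidSolution N →
          (∀ b : {b // b ∈ Bt},
            Tendsto (fun t => S.mu b (N t b)) atTop (𝓝 (S.mu b (Nopt b)))) ∧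
          (∀ b, b ∉ Bt →
            Tendsto (fun t => S.mu b (N t b)) atTop (𝓝 (S.capacity b))) := by
  obtain ⟨W, n, q, y, M, z, hE, hM, hz, hMz, hMW, hMV⟩ := hS.exists_extendedEquilibrium
  have hD := hE.isStabilityDecomposition hS
  refine ⟨⟨(_, W), hD, fun D hD' => ?_⟩, fun Ft Bt hD' => ?_⟩
  · exact Prod.ext_iff.2 (hD'.unique hS hD)
  obtain rfl : Bt = W := (hD'.unique hS hD).2
  refine ⟨fun b => n b, ⟨fun f b => y f b, hE.fluidFeasible hS hD'.frontends,
    fun N' x' h => (hE.sum_le_sum hS hD'.frontends h).1⟩, fun N' x' h => ?_, fun N hN => ?_⟩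
  · exact (hE.sum_le_sum hS hD'.frontends h.1).2 (h.2 _ _ (hE.fluidFeasible hS hD'.frontends))
  -- As `k` grows, these bounds reach every level below `n b` on `Bt`, and every level at all
  -- outside it.
  have hlow : ∀ k b a, a < M k b → ∀ᶠ t in atTop, a < N t b := fun k b a ha =>
    eventually_lt_of_tendsto_posPart ha
      (hN.tendsto_posPart_rsub_zero hS (hM k) (hz k) (hMz k) b)
  have hnonneg : ∀ b, ∀ᶠ t in atTop, 0 ≤ N t b := fun b => by
    filter_upwards [eventually_ge_atTop 0] with t ht using hN.nonneg t ht b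
  refine ⟨fun b => ?_, fun b hb => ?_⟩
  · refine hS.tendsto_mu b (hnonneg b) (hE.nonneg b) (tendsto_order.2 ⟨fun a ha => ?_,
      fun a ha => ?_⟩)
    · obtain ⟨k, hk⟩ := ((hMW b b.2).eventually_const_lt ha).exists
      exact hlow k b a hk
    · filter_upwards [(hN.tendsto_posPart_sub_zero hS hE b.2).eventually_lt_const
        (sub_pos.2 ha)] with t ht
      have := (le_max_left _ _).trans_lt ht
      linarith
  · refine (hS.tendsto_capacity b).comp (tendsto_atTop.2 fun a => ?_)
    obtain ⟨k, hk⟩ := ((hMV b hb).eventually_gt_atTop a).exists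
    filter_upwards [hlow k b a hk] with t ht using ht.le
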